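/- Let $d\in\mathbb{N}$, let $B_d$ be the open Euclidean unit ball of $\mathbb{C}^d$, and let $\mathcal{H}^2_d$ be the Drury–Arveson space, i.e. the reproducing kernel Hilbert space of functions on $B_d$ with kernel $k(x,y)=\frac{1}{1-\langle x,y\rangle}$, where $\langle x,y\rangle=\sum_{i=1}^d x_i\overline{y_i}$. A function $f:B_d\to\mathbb{C}$ is a multiplier of $\mathcal{H}^2_d$ if $fg\in\mathcal{H}^2_d$ for all $g\in\mathcal{H}^2_d$; it then defines a bounded operator $M_f g=fg$ on $\mathcal{H}^2_d$. Let $A:\mathbb{C}^d\to\mathbb{C}^d$ be a linear map, with components $A_i(x)=\langle Ax,e_i\rangle$, $i=1,\dots,d$, where $e_1,\dots,e_d$ is the standard basis. Then each $A_i$, restricted to $B_d$, is a multiplier of $\mathcal{H}^2_d$, and the row operator $$M_A=(M_{A_1},\dots,M_{A_d}):\bigoplus_{i=1}^d\mathcal{H}^2_d\longrightarrow\mathcal{H}^2_d,\qquad M_A(g_1,\dots,g_d)=\sum_{i=1}^d A_i g_i,$$ on the Hilbert space direct sum satisfies $$\|M_A\|=\|A\|_{OP},$$ where $\|A\|_{OP}$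 is the operator norm of $A$ with respect to the Euclidean norm on $\mathbb{C}^d$. -/

import Mathlib

noncomputable section

namespace DruryArveson

open scoped ComplexConjugate ComplexOrder

/-! ### Multipliers of a Hilbert space of complex-valued functions -/

section Multipliers

variable {X : Type*} (H : Type*) [NormedAddCommGroup H] [InnerProductSpace ℂ H]
  [RKHS ℂ H X ℂ]

/-- `f : X → ℂ` is a multiplier of the reproducing kernel Hilbert space `H` on `X` if the pointwise
product `f * g` belongs to `H` for every `g` in `H`. -/
def IsMultiplier (f : X → ℂ) : Prop :=
  ∀ g : H, ∃ h : H, ∀ x, h x = f x * g x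

/-- A tuple `F = (f₁, …, f_d)` is a vector valued multiplier if each `f_i` is a multiplier. -/
def IsVectorMultiplier {d : ℕ} (F : Fin d → X → ℂ) : Prop :=
  ∀ i, IsMultiplier H (F i)

variable {H}

/-- The product `f * g` as an element of `H`. -/
def mulFun {f : X → ℂ} (hf : IsMultiplier H f) (g : H) : H :=
  (hf g).choose

theorem mulFun_apply {f : X → ℂ} (hf : IsMultiplier H f) (g : H) (x : X) :
    mulFun hf g x = f x * g x :=
  (hf g).choose_spec x

/-- The multiplication map `g ↦ f * g` on `H`, as a linear map. -/
def mulLin {f : X → ℂ} (hf : IsMultiplier H f) : H →ₗ[ℂ] H where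
  toFun := mulFun hf
  map_add' g g' := RKHS.ext fun x ↦ by
    simp only [RKHS.coe_add, Pi.add_apply, mulFun_apply, mul_add]
  map_smul' c g := RKHS.ext fun x ↦ by
    simp only [RKHS.coe_smul, Pi.smul_apply, mulFun_apply, smul_eq_mul, RingHom.id_apply]
    ring

theorem mulLin_apply {f : X → ℂ} (hf : IsMultiplier H f) (g : H) (x : X) :
    mulLin hf g x = f x * g x :=
  mulFun_apply hf g x

/-- The bounded multiplication operator `M_f g = f * g` on `H`; boundedness is automatic, by the
closed graph theorem. -/
def mulOp [CompleteSpace H] {f : X → ℂ} (hf : IsMultiplier H f) : H →L[ℂ] H :=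
  ContinuousLinearMap.ofSeqClosedGraph (g := mulLin hf) fun u g h hu hv ↦ RKHS.ext fun x ↦ by
    have h1 := ((RKHS.continuous_eval (H := H) x).tendsto h).comp hv
    have h2 := (((RKHS.continuous_eval (H := H) x).tendsto g).comp hu).const_mul (f x)
    rw [mulLin_apply]
    refine tendsto_nhds_unique h1 (h2.congr fun n ↦ ?_)
    simp only [Function.comp_apply, mulLin_apply]

theorem mulOp_apply [CompleteSpace H] {f : X → ℂ} (hf : IsMultiplier H f) (g : H) (x : X) :
    mulOp hf g x = f x * g x :=
  mulLin_apply hf g x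

/-- The row operator `M_F (g₁, …, g_d) = f₁ g₁ + ⋯ + f_d g_d` from the Hilbert space direct sum
of `d` copies of `H` to `H`. -/
def rowOp [CompleteSpace H] {d : ℕ} {F : Fin d → X → ℂ} (hF : IsVectorMultiplier H F) :
    PiLp 2 (fun _ : Fin d ↦ H) →L[ℂ] H :=
  ∑ i, (mulOp (hF i)).comp (PiLp.proj 2 (fun _ : Fin d ↦ H) i)

theorem rowOp_apply [CompleteSpace H] {d : ℕ} {F : Fin d → X → ℂ} (hF : IsVectorMultiplier H F)
    (g : PiLp 2 (fun _ : Fin d ↦ H)) (x : X) :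
    rowOp hF g x = ∑ i, F i x * g i x := by
  have h1 : rowOp hF g = ∑ i, mulOp (hF i) (g i) := by
    simp only [rowOp, _root_.sum_apply]
    rfl
  have h2 : RKHS.coeCLM ℂ (∑ i, mulOp (hF i) (g i)) x = ∑ i, mulOp (hF i) (g i) x := by
    rw [map_sum, Finset.sum_apply]
    rfl
  rw [h1, ← RKHS.coeCLM_apply, h2]
  exact Finset.sum_congr rfl fun i _ ↦ mulOp_apply (hF i) (g i) x

end Multipliers

/-! ### The Drury-Arveson space -/

/-- The open Euclidean unit ball of `ℂ^d`. -/
abbrev Ball (d : ℕ) : Type := Metric.ball (0 : EuclideanSpace ℂ (Fin d)) 1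

/-- The kernel `k(x, y) = 1 / (1 - ⟨x, y⟩)` on the ball, where `⟨x, y⟩ = ∑ i, x i * conj (y i)`
(which is `inner ℂ y x`); a scalar is regarded as an operator on `ℂ`. -/
def kernel (d : ℕ) : Matrix (Ball d) (Ball d) (ℂ →L[ℂ] ℂ) :=
  .of fun x y ↦ (1 - inner ℂ (y : EuclideanSpace ℂ (Fin d)) x)⁻¹ • ContinuousLinearMap.id ℂ ℂ

theorem norm_inner_lt_one {d : ℕ} (x y : Ball d) :
    ‖inner ℂ (x : EuclideanSpace ℂ (Fin d)) (y : EuclideanSpace ℂ (Fin d))‖ < 1 := by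
  have hx : ‖(x : EuclideanSpace ℂ (Fin d))‖ < 1 := mem_ball_zero_iff.mp x.2
  have hy : ‖(y : EuclideanSpace ℂ (Fin d))‖ < 1 := mem_ball_zero_iff.mp y.2
  calc _ ≤ ‖(x : EuclideanSpace ℂ (Fin d))‖ * ‖(y : EuclideanSpace ℂ (Fin d))‖ :=
        norm_inner_le_norm _ _
    _ < 1 := by nlinarith [norm_nonneg (x : EuclideanSpace ℂ (Fin d)),
        norm_nonneg (y : EuclideanSpace ℂ (Fin d))]

theorem posSemidef_kernel (d : ℕ) : (kernel d).PosSemidef := by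
  refine ((RKHS.posSemidef_tfae (K := kernel d)).out 0 2).mpr (And.intro ?_ fun w ↦ ?_)
  · ext x y
    simp [kernel, ContinuousLinearMap.star_eq_adjoint, ContinuousLinearMap.adjoint_id]
  · have key : HasSum (fun n : ℕ ↦ ∑ x ∈ w.support, ∑ y ∈ w.support,
        w y * conj (w x) * inner ℂ (y : EuclideanSpace ℂ (Fin d)) x ^ n)
        (w.sum fun x a ↦ w.sum fun y b ↦ inner ℂ (kernel d y x a) b) := by
      simp only [Finsupp.sum]
      refine hasSum_sum fun x _ ↦ hasSum_sum fun y _ ↦ ?_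
      have := (hasSum_geometric_of_norm_lt_one (norm_inner_lt_one y x)).mul_left
        (w y * conj (w x))
      have e : inner ℂ (kernel d y x (w x)) (w y) =
          w y * conj (w x) * (1 - inner ℂ (y : EuclideanSpace ℂ (Fin d)) x)⁻¹ := by
        simp [kernel]
        ring
      exact e ▸ this
    refine (Complex.hasSum_re key).nonneg fun n ↦ ?_
    have hsq : ∑ x ∈ w.support, ∑ y ∈ w.support,
        w y * conj (w x) * inner ℂ (y : EuclideanSpace ℂ (Fin d)) x ^ n =
        ∑ s : Fin n → Fin d,
          (∑ x ∈ w.support, w x * ∏ i, conj (x.1 (s i))) *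
            conj (∑ x ∈ w.support, w x * ∏ i, conj (x.1 (s i))) := by
      simp only [PiLp.inner_apply, RCLike.inner_apply, Fintype.sum_pow, map_sum,
        Finset.sum_mul_sum]
      rw [Finset.sum_comm]
      symm
      rw [Finset.sum_comm]
      refine Finset.sum_congr rfl fun x _ ↦ ?_
      rw [Finset.sum_comm]
      refine Finset.sum_congr rfl fun y _ ↦ ?_
      rw [Finset.mul_sum]
      refine Finset.sum_congr rfl fun s _ ↦ ?_
      simp only [map_mul, map_prod, Complex.conj_conj, Finset.prod_mul_distrib]
      ring
    rw [hsq, Complex.re_sum]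
    refine Finset.sum_nonneg fun s _ ↦ ?_
    rw [Complex.mul_conj, Complex.ofReal_re]
    exact Complex.normSq_nonneg _

instance fact_posSemidef_kernel (d : ℕ) : Fact (kernel d).PosSemidef := ⟨posSemidef_kernel d⟩

/-- The Drury-Arveson space `H²_d`: the reproducing kernel Hilbert space on the ball `B_d` with
kernel `1 / (1 - ⟨x, y⟩)`, the completion of the span of the kernel functions. -/
abbrev Space (d : ℕ) : Type := RKHS.OfKernel (kernel d)

/-- The components `A_i(x) = ⟨A x, e_i⟩`, restricted to the ball, of a linear map
`A : ℂ^d → ℂ^d`. -/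
def components {d : ℕ} (A : EuclideanSpace ℂ (Fin d) →ₗ[ℂ] EuclideanSpace ℂ (Fin d)) :
    Fin d → Ball d → ℂ :=
  fun i x ↦ A x i

end DruryArveson

end

/-!
Write `k_x` for the kernel function at `x`. The adjoint of a row operator `M_F` acts on kernel
functions by `k_x ↦ (conj (F i x) • k_x)_i`, and everything is read off from this formula.

For the lower bound, the image of `k_x` under the adjoint of `M_A` has norm `‖A x‖ * ‖k_x‖`, so
`‖A x‖ ≤ ‖M_A‖` for every `x` in the ball (`norm_toLp_le_norm_rowOp`), and the supremum of `‖A x‖`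
over the ball is `‖A‖`.

For the upper bound, it suffices to bound the formal adjoint on the dense span of the kernel
functions: it then extends to a bounded operator whose adjoint is the row operator, which also
shows that the `F i` are multipliers (`exists_isVectorMultiplier_norm_rowOp_le`). For the
coordinate functions the formal adjoint is a contraction, because `(1 - ⟨x, y⟩) k(x, y) = 1` is a
positive semidefinite kernel (`norm_rowAdjoint_coordinates_le`). For general `A` the formal adjoint
is the one for the coordinates followed by the conjugate matrix of `A` acting on `d`-tuples of
vectors, and this action has norm at most `‖A‖` (`norm_le_of_inner_eq`).
-/

namespace DruryArveson

open scoped ComplexConjugate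

/-! ### Row operators and their action on kernel functions -/

section Criterion

variable {X : Type*} (H : Type*) [NormedAddCommGroup H] [InnerProductSpace ℂ H]
  [RKHS ℂ H X ℂ] [CompleteSpace H]

/-- The linear map sending a finitely supported family `w` of scalars to the combination
`∑ x, w x • k_x` of the kernel functions of `H`. -/
noncomputable def kerComb : (X →₀ ℂ) →ₗ[ℂ] H :=
  Finsupp.linearCombination ℂ fun x ↦ RKHS.kerFun H x 1

/-- The adjoint of the row operator of `F`, on combinations of kernel functions: the linear map
sending `w` to `∑ x, w x • (conj (F i x) • k_x)_i`. It makes sense for every tuple `F`, whether or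
not the `F i` are multipliers. -/
noncomputable def rowAdjoint {d : ℕ} (F : Fin d → X → ℂ) :
    (X →₀ ℂ) →ₗ[ℂ] PiLp 2 (fun _ : Fin d ↦ H) :=
  Finsupp.linearCombination ℂ fun x ↦ WithLp.toLp 2 fun i ↦ conj (F i x) • RKHS.kerFun H x 1

theorem denseRange_kerComb : DenseRange (kerComb (X := X) H) := by
  have h := RKHS.kerFun_dense (𝕜 := ℂ) (X := X) (V := ℂ) H
  rw [← Submodule.dense_iff_topologicalClosure_eq_top] at h
  refine h.mono ?_
  rw [← LinearMap.coe_range, SetLike.coe_subset_coe, Submodule.span_le]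
  rintro _ ⟨x, v, rfl⟩
  refine ⟨Finsupp.single x v, ?_⟩
  rw [kerComb, Finsupp.linearCombination_single, ← map_smul, smul_eq_mul, mul_one]

variable {H}

/-- A bound for the formal adjoint of the row operator on combinations of kernel functions makes
`F` a vector multiplier, and bounds its row operator. -/
theorem exists_isVectorMultiplier_norm_rowOp_le {d : ℕ} {F : Fin d → X → ℂ} {C : ℝ} (hC : 0 ≤ C)
    (h : ∀ w, ‖rowAdjoint H F w‖ ≤ C * ‖kerComb H w‖) :
    ∃ hF : IsVectorMultiplier H F, ‖rowOp hF‖ ≤ C := by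
  set T := (rowAdjoint H F).extendOfNorm (kerComb H)
  have hT (x : X) : T (RKHS.kerFun H x 1) =
      WithLp.toLp 2 fun i ↦ conj (F i x) • RKHS.kerFun H x 1 := by
    have := LinearMap.extendOfNorm_eq (denseRange_kerComb H) ⟨C, h⟩ (Finsupp.single x 1)
    rwa [kerComb, rowAdjoint, Finsupp.linearCombination_single, Finsupp.linearCombination_single,
      one_smul, one_smul] at this
  have hadj (g : PiLp 2 (fun _ : Fin d ↦ H)) (x : X) : T.adjoint g x = ∑ i, F i x * g i x := by
    have : inner ℂ (RKHS.kerFun H x 1) (T.adjoint g) = ∑ i, F i x * g i x := by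
      rw [ContinuousLinearMap.adjoint_inner_right, hT, PiLp.inner_apply]
      refine Finset.sum_congr rfl fun i _ ↦ ?_
      rw [inner_smul_left, RKHS.kerFun_inner]
      simp
    simpa using this
  have hF : IsVectorMultiplier H F := fun i g ↦ ⟨T.adjoint (PiLp.single 2 i g), fun x ↦ by
    rw [hadj, Finset.sum_eq_single_of_mem i (Finset.mem_univ i) fun j _ hj ↦ by
      simp [hj]]
    simp⟩
  refine ⟨hF, ?_⟩
  have : rowOp hF = T.adjoint := by
    ext g x
    rw [rowOp_apply, hadj]
  rw [this, LinearIsometryEquiv.norm_map]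
  exact LinearMap.opNorm_extendOfNorm_le (denseRange_kerComb H) hC h

/-- The adjoint of `rowOp hF` sends the kernel function `k_x` to `(conj (F i x) • k_x)_i`, a tuple
whose norm is that of `(F i x)_i` times `‖k_x‖`. -/
theorem norm_toLp_le_norm_rowOp {d : ℕ} {F : Fin d → X → ℂ} (hF : IsVectorMultiplier H F) (x : X)
    (hx : RKHS.kerFun H x 1 ≠ 0) : ‖WithLp.toLp 2 fun i ↦ F i x‖ ≤ ‖rowOp hF‖ := by
  have h : (rowOp hF).adjoint (RKHS.kerFun H x 1) =
      WithLp.toLp 2 fun i ↦ conj (F i x) • RKHS.kerFun H x 1 := by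
    refine ext_inner_right ℂ fun g ↦ ?_
    rw [ContinuousLinearMap.adjoint_inner_left, RKHS.kerFun_inner, rowOp_apply, PiLp.inner_apply]
    simp [inner_smul_left]
  have hn : ‖(WithLp.toLp 2 fun i ↦ conj (F i x) • RKHS.kerFun H x 1 :
      PiLp 2 (fun _ : Fin d ↦ H))‖ = ‖WithLp.toLp 2 fun i ↦ F i x‖ * ‖RKHS.kerFun H x 1‖ := by
    rw [← sq_eq_sq₀ (norm_nonneg _) (by positivity), mul_pow, PiLp.norm_sq_eq_of_L2,
      PiLp.norm_sq_eq_of_L2, Finset.sum_mul]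
    simp [norm_smul, mul_pow]
  refine le_of_mul_le_mul_right ?_ (norm_pos_iff.mpr hx)
  rw [← hn, ← h, ← LinearIsometryEquiv.norm_map ContinuousLinearMap.adjoint (rowOp hF)]
  exact ContinuousLinearMap.le_opNorm _ _

end Criterion

/-! ### Linear maps acting on tuples of vectors of a Hilbert space -/

/-- Parseval's identity. -/
theorem hasSum_norm_inner_sq {ι H : Type*} [NormedAddCommGroup H] [InnerProductSpace ℂ H]
    (b : HilbertBasis ι ℂ H) (x : H) : HasSum (fun i ↦ ‖inner ℂ x (b i)‖ ^ 2) (‖x‖ ^ 2) := by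
  have h := Complex.hasSum_re (b.hasSum_inner_mul_inner x x)
  have e : (inner ℂ x x).re = ‖x‖ ^ 2 := inner_self_eq_norm_sq (𝕜 := ℂ) x
  rw [e] at h
  refine h.congr_fun fun i ↦ ?_
  rw [← inner_conj_symm (b i) x, Complex.mul_conj, Complex.ofReal_re, Complex.normSq_eq_norm_sq]

/-- If the tuple `u` arises from `v` by letting `A` act on the index, then `‖u‖ ≤ ‖A‖ * ‖v‖`: by
Parseval, both norms are computed coordinate by coordinate in a Hilbert basis of `H`, where the
bound is that of `A` on `ℂ^d`. The relation is tested against vectors `e` on the right, so that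
`A`, and not its complex conjugate, acts on the conjugate coordinates. -/
theorem norm_le_of_inner_eq {H : Type*} [NormedAddCommGroup H] [InnerProductSpace ℂ H]
    [CompleteSpace H] {d : ℕ} (A : EuclideanSpace ℂ (Fin d) →L[ℂ] EuclideanSpace ℂ (Fin d))
    (u v : PiLp 2 (fun _ : Fin d ↦ H))
    (h : ∀ (e : H) i, inner ℂ (u i) e = A (WithLp.toLp 2 fun j ↦ inner ℂ (v j) e) i) :
    ‖u‖ ≤ ‖A‖ * ‖v‖ := by
  obtain ⟨s, b, -⟩ := exists_hilbertBasis ℂ H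
  have key (w : PiLp 2 (fun _ : Fin d ↦ H)) :
      HasSum (fun e ↦ ‖WithLp.toLp 2 fun j ↦ inner ℂ (w j) (b e)‖ ^ 2) (‖w‖ ^ 2) := by
    simp only [PiLp.norm_sq_eq_of_L2]
    exact hasSum_sum fun i _ ↦ hasSum_norm_inner_sq b (w i)
  refine le_of_sq_le_sq ?_ (by positivity)
  rw [mul_pow]
  refine hasSum_le (fun e ↦ ?_) (key u) ((key v).mul_left (‖A‖ ^ 2))
  have : (WithLp.toLp 2 fun j ↦ inner ℂ (u j) (b e)) =
      A (WithLp.toLp 2 fun j ↦ inner ℂ (v j) (b e)) := by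
    ext i
    exact h (b e) i
  rw [this, ← mul_pow]
  gcongr
  exact A.le_opNorm _

/-! ### The Drury-Arveson space -/

theorem inner_kerFun_kerFun {d : ℕ} (x y : Ball d) :
    inner ℂ (RKHS.kerFun (Space d) x 1) (RKHS.kerFun (Space d) y 1) =
      (1 - inner ℂ (y : EuclideanSpace ℂ (Fin d)) x)⁻¹ := by
  rw [RKHS.kerFun_inner, RKHS.kerFun_apply, RKHS.OfKernel.kernel_ofKernel]
  simp [kernel]

theorem one_sub_inner_ne_zero {d : ℕ} (x y : Ball d) :
    1 - inner ℂ (x : EuclideanSpace ℂ (Fin d)) (y : EuclideanSpace ℂ (Fin d)) ≠ 0 := fun h ↦ by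
  have := norm_inner_lt_one x y
  rw [← sub_eq_zero.mp h, norm_one] at this
  exact lt_irrefl _ this

theorem kerFun_ne_zero {d : ℕ} (x : Ball d) : RKHS.kerFun (Space d) x 1 ≠ 0 := fun h ↦ by
  have := inner_kerFun_kerFun x x
  rw [h, inner_zero_left] at this
  exact inv_ne_zero (one_sub_inner_ne_zero x x) this.symm

theorem inner_linearCombination {X E : Type*} [NormedAddCommGroup E] [InnerProductSpace ℂ E]
    (a : X → E) (w : X →₀ ℂ) :
    inner ℂ (Finsupp.linearCombination ℂ a w) (Finsupp.linearCombination ℂ a w) =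
      ∑ x ∈ w.support, ∑ y ∈ w.support, conj (w x) * w y * inner ℂ (a x) (a y) := by
  simp only [Finsupp.linearCombination_apply, Finsupp.sum, sum_inner]
  refine Finset.sum_congr rfl fun x _ ↦ ?_
  rw [inner_sum]
  refine Finset.sum_congr rfl fun y _ ↦ ?_
  rw [inner_smul_left, inner_smul_right, mul_assoc]

/-- The coordinate functions form a row contraction: since `(1 - ⟨x, y⟩) k(x, y) = 1`, the
difference of the two squared norms is `|∑ x, w x| ^ 2`. -/
theorem norm_rowAdjoint_coordinates_le {d : ℕ} (w : Ball d →₀ ℂ) :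
    ‖rowAdjoint (Space d) (fun i (x : Ball d) ↦ x.1 i) w‖ ≤ ‖kerComb (Space d) w‖ := by
  have h : inner ℂ (kerComb (Space d) w) (kerComb (Space d) w) =
      inner ℂ (rowAdjoint (Space d) (fun i (x : Ball d) ↦ x.1 i) w)
        (rowAdjoint (Space d) (fun i (x : Ball d) ↦ x.1 i) w) +
      inner ℂ (Finsupp.linearCombination ℂ (fun _ : Ball d ↦ (1 : ℂ)) w)
        (Finsupp.linearCombination ℂ (fun _ : Ball d ↦ (1 : ℂ)) w) := by
    simp only [kerComb, rowAdjoint, inner_linearCombination, ← Finset.sum_add_distrib, ← mul_add]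
    refine Finset.sum_congr rfl fun x _ ↦ Finset.sum_congr rfl fun y _ ↦ ?_
    congr 1
    have e : inner ℂ (WithLp.toLp 2 fun i ↦ conj (x.1 i) • RKHS.kerFun (Space d) x 1)
        (WithLp.toLp 2 fun i ↦ conj (y.1 i) • RKHS.kerFun (Space d) y 1) =
        inner ℂ (y : EuclideanSpace ℂ (Fin d)) x *
          (1 - inner ℂ (y : EuclideanSpace ℂ (Fin d)) x)⁻¹ := by
      set c := (1 - inner ℂ (y : EuclideanSpace ℂ (Fin d)) x)⁻¹ with hc
      rw [PiLp.inner_apply, PiLp.inner_apply, Finset.sum_mul]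
      refine Finset.sum_congr rfl fun i _ ↦ ?_
      rw [inner_smul_left, inner_smul_right, inner_kerFun_kerFun, ← hc, RCLike.inner_apply,
        Complex.conj_conj, mul_assoc]
    have ne := one_sub_inner_ne_zero y x
    rw [e, inner_kerFun_kerFun, RCLike.inner_apply, map_one, mul_one]
    field_simp
    ring
  simp only [inner_self_eq_norm_sq_to_K] at h
  norm_cast at h
  refine le_of_sq_le_sq ?_ (norm_nonneg _)
  rw [h]
  exact le_add_of_nonneg_right (sq_nonneg _)

/-- The formal adjoint for `A` is the one for the coordinate functions followed by the conjugate of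
the matrix of `A` acting on the index; the first is a contraction. -/
theorem norm_rowAdjoint_components_le {d : ℕ}
    (A : EuclideanSpace ℂ (Fin d) →ₗ[ℂ] EuclideanSpace ℂ (Fin d)) (w : Ball d →₀ ℂ) :
    ‖rowAdjoint (Space d) (components A) w‖ ≤
      ‖A.toContinuousLinearMap‖ * ‖kerComb (Space d) w‖ := by
  refine (norm_le_of_inner_eq A.toContinuousLinearMap _
    (rowAdjoint (Space d) (fun i (x : Ball d) ↦ x.1 i) w) fun e i ↦ ?_).trans ?_
  · have hi (F : Fin d → Ball d → ℂ) (i : Fin d) : inner ℂ (rowAdjoint (Space d) F w i) e =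
        ∑ x ∈ w.support, (conj (w x) * inner ℂ (RKHS.kerFun (Space d) x 1) e) * F i x := by
      simp only [rowAdjoint, Finsupp.linearCombination_apply, Finsupp.sum, WithLp.ofLp_sum,
        Finset.sum_apply, sum_inner]
      refine Finset.sum_congr rfl fun x _ ↦ ?_
      rw [PiLp.smul_apply, inner_smul_left, inner_smul_left, Complex.conj_conj]
      ring
    have hv : (WithLp.toLp 2 fun j ↦
        inner ℂ (rowAdjoint (Space d) (fun i (x : Ball d) ↦ x.1 i) w j) e) =
        ∑ x ∈ w.support, (conj (w x) * inner ℂ (RKHS.kerFun (Space d) x 1) e) • x.1 := by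
      ext j
      simp [hi]
    rw [hi, hv, map_sum, WithLp.ofLp_sum, Finset.sum_apply]
    refine Finset.sum_congr rfl fun x _ ↦ ?_
    rw [map_smul]
    rfl
  · gcongr
    exact norm_rowAdjoint_coordinates_le w

end DruryArveson

theorem theorem5p5 (d : ℕ)
    (A : EuclideanSpace ℂ (Fin d) →ₗ[ℂ] EuclideanSpace ℂ (Fin d)) :
    ∃ hA : DruryArveson.IsVectorMultiplier (DruryArveson.Space d) (DruryArveson.components A),
      ‖DruryArveson.rowOp hA‖ = ‖A.toContinuousLinearMap‖ := by
  obtain ⟨hA, hle⟩ :=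
    DruryArveson.exists_isVectorMultiplier_norm_rowOp_le (norm_nonneg _)
      (DruryArveson.norm_rowAdjoint_components_le A)
  refine ⟨hA, hle.antisymm ?_⟩
  rw [← A.toContinuousLinearMap.sSup_unit_ball_eq_norm]
  refine csSup_le ((Metric.nonempty_ball.mpr one_pos).image _) ?_
  rintro _ ⟨x, hx, rfl⟩
  -- The entries of `components A` at `x` are those of `A x`.
  exact DruryArveson.norm_toLp_le_norm_rowOp hA ⟨x, hx⟩ (DruryArveson.kerFun_ne_zero _)
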